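/- Let $n\ge 0$ and $\mathbb{Q}[X]=\mathbb{Q}[x_1,\dots,x_n]$. For $\nu\in\mathbb{N}^n$ write $X^\nu=x_1^{\nu_1}\cdots x_n^{\nu_n}$, and let $c(\nu)$ be the composition (finite sequence of positive integers) obtained from $\nu$ by erasing its zeros. A polynomial is quasi-symmetric if the coefficients of $X^\nu$ and $X^\mu$ in it agree whenever $c(\nu)=c(\mu)$. Let $J_n$ be the ideal of $\mathbb{Q}[X]$ generated by the quasi-symmetric polynomials with no constant term, and $R_n=\mathbb{Q}[X]/J_n$. To $\nu\in\mathbb{N}^n$ associate the lattice path $\pi(\nu)$ $$(0,0)\to(\nu_1,0)\to(\nu_1,1)\to(\nu_1+\nu_2,1)\to(\nu_1+\nu_2,2)\to\cdots\to(\nu_1+\cdots+\nu_n,n-1)\to(\nu_1+\cdots+\nu_n,n).$$ Call $\nu$ Dyck if $\pi(\nu)$ stays weakly above the diagonal $y=x$, and transdiagonal otherwise. For a composition $\alpha=(\alpha_1,\dots,\alpha_k)$ of $d$ let $D(\alpha)=\{\alpha_1,\alpha_1+\alpha_2,\dots,\alpha_1+\cdots+\alpha_{k-1}\}$, let $M_\alpha=\sum_{c(\nu)=\alpha}X^\nu$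 (sum over $\nu\in\mathbb{N}^n$), and let $F_\alpha=\sum_\beta M_\beta$, the sum over all compositions $\beta$ of $d$ with $D(\alpha)\subseteq D(\beta)$. For $\varepsilon\in\mathbb{N}^n$ define $G_\varepsilon\in\mathbb{Q}[X]$ recursively as follows. If $\varepsilon=\alpha 0\cdots0$ with $\alpha$ a composition with at most $n$ parts, then $G_\varepsilon=F_\alpha$. Otherwise write uniquely $\varepsilon=w\,0\,a\,\beta\,0\cdots0$ with $w\in\mathbb{N}^{k-1}$, $a>0$ and $\beta$ a (possibly empty) composition, and put $$G_\varepsilon=G_{w\,a\,\beta\,0\cdots0}-x_k\,G_{w\,(a-1)\,\beta\,0\cdots0},$$ where the vectors are completed by zeros to length $n$. Theorem. 1. The classes of the monomials $X^\eta$, for $\eta\in\mathbb{N}^n$ Dyck, form a linear basis of $R_n$ over $\mathbb{Q}$. 2. The polynomials $G_\varepsilon$, for $\varepsilon\in\mathbb{N}^n$ transdiagonal, form a linear basis of $J_n$ over $\mathbb{Q}$. 3. These polynomials are a (possibly infinite) Gröbner basis of $J_n$ for the graded lexicographic order with $x_1>\cdots>x_n$: they lie in $J_n$, and their leading terms generate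 the ideal generated by the leading terms of all elements of $J_n$. -/

import Mathlib

open MvPolynomial

namespace QuasiSym

/-- The composition `c(ν)` of the integer `|ν|` obtained by erasing the zeros of the vector `ν`. -/
def comp {n : ℕ} (ν : Fin n →₀ ℕ) : Composition (∑ i, ν i) where
  blocks := (List.ofFn fun i => ν i).filter fun a => 0 < a
  blocks_pos := by
    intro a ha
    simpa using (List.mem_filter.1 ha).2
  blocks_sum := by
    have key : ∀ l : List ℕ, (l.filter fun a => 0 < a).sum = l.sum := by
      intro l
      induction l with
      | nil => rfl
      | cons a l ih =>
        rcases Nat.eq_zero_or_pos a with rfl | h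
        · simpa using ih
        · simpa [h] using ih
    rw [key, List.sum_ofFn]

/-- A polynomial is quasi-symmetric if the coefficients of `X^ν` and `X^μ` agree
whenever `c(ν) = c(μ)`. -/
def IsQuasiSymmetric {n : ℕ} (P : MvPolynomial (Fin n) ℚ) : Prop :=
  ∀ ν μ : Fin n →₀ ℕ, (comp ν).blocks = (comp μ).blocks → P.coeff ν = P.coeff μ

/-- The ideal `J_n` generated by the quasi-symmetric polynomials with no constant term. -/
noncomputable def idealJ (n : ℕ) : Ideal (MvPolynomial (Fin n) ℚ) :=
  Ideal.span {P | IsQuasiSymmetric P ∧ constantCoeff P = 0}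

/-- The successive corners of the lattice path `π(ν)`:
`(0,0), (ν₁,0), (ν₁,1), (ν₁+ν₂,1), (ν₁+ν₂,2), …, (ν₁+⋯+νₙ,n-1), (ν₁+⋯+νₙ,n)`
(the index `i : Fin n` stands for the position `i + 1`). Two consecutive corners are joined by a
horizontal or vertical segment. -/
def latticePath {n : ℕ} (ν : Fin n →₀ ℕ) : List (ℕ × ℕ) :=
  (0, 0) :: (List.finRange n).flatMap fun i =>
    [(∑ j ∈ Finset.Iic i, ν j, (i : ℕ)), (∑ j ∈ Finset.Iic i, ν j, (i : ℕ) + 1)]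

/-- `ν` is Dyck if the path `π(ν)` stays weakly above the diagonal `y = x`. As the half-plane
`x ≤ y` is convex, this is a condition on the corners of the path. -/
def IsDyck {n : ℕ} (ν : Fin n →₀ ℕ) : Prop :=
  ∀ p ∈ latticePath ν, p.1 ≤ p.2

/-- `ν` is transdiagonal if it is not Dyck. -/
def IsTransdiagonal {n : ℕ} (ν : Fin n →₀ ℕ) : Prop :=
  ¬ IsDyck ν

/-- The monomial quasi-symmetric polynomial `M_α`, the sum of all `X^ν` with `c(ν) = α`
(such vectors `ν` have size `d`). -/
noncomputable def monomialQSym (n : ℕ) {d : ℕ} (α : Composition d) : MvPolynomial (Fin n) ℚ :=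
  ∑ ν ∈ (Finset.finsuppAntidiag (Finset.univ : Finset (Fin n)) d).filter
    (fun ν => (comp ν).blocks = α.blocks), monomial ν 1

/-- The fundamental quasi-symmetric polynomial `F_α`, the sum of the `M_β` over the refinements
`β` of `α`. The boundaries of a composition of `d` are the elements of the associated subset of
`{1, …, d - 1}` together with `0` and `d`. -/
noncomputable def fundamentalQSym (n : ℕ) {d : ℕ} (α : Composition d) : MvPolynomial (Fin n) ℚ :=
  ∑ β : Composition d with α.boundaries ⊆ β.boundaries, monomialQSym n β

/-- The positions `k` such that `ε_k = 0` and `ε_{k+1} > 0`. There is none if and only if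
`ε = α0^*` for a composition `α`; otherwise the largest one is the position of the displayed zero
in the factorization `ε = w0aβ0^*` with `a > 0` and `β` a composition. -/
def gaps {n : ℕ} (ε : Fin n →₀ ℕ) : Finset (Fin n) :=
  Finset.univ.filter fun k => ε k = 0 ∧ ∃ h : (k : ℕ) + 1 < n, 0 < ε ⟨k + 1, h⟩

/-- Delete the entry at position `k` and add a zero at the end: `w0aβ0^* ↦ waβ0^*`. -/
noncomputable def removeAt {n : ℕ} (ε : Fin n →₀ ℕ) (k : Fin n) : Fin n →₀ ℕ :=
  Finsupp.equivFunOnFinite.symm fun i =>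
    if i < k then ε i else if h : (i : ℕ) + 1 < n then ε ⟨i + 1, h⟩ else 0

/-- The position `ℓ(ν)` of the last non-zero component of `ν` (`0` if `ν = 0`). -/
def lastPos {n : ℕ} (ν : Fin n →₀ ℕ) : ℕ :=
  ν.support.sup fun i => (i : ℕ) + 1

theorem lastPos_removeAt_lt {n : ℕ} (ε : Fin n →₀ ℕ) (k : Fin n) (hk : k ∈ gaps ε) :
    lastPos (removeAt ε k) < lastPos ε := by
  obtain ⟨-, -, hkn, hpos⟩ := Finset.mem_filter.1 hk
  have hle : ∀ j : Fin n, ε j ≠ 0 → (j : ℕ) + 1 ≤ lastPos ε := fun j hj =>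
    Finset.le_sup (f := fun i : Fin n => (i : ℕ) + 1) (Finsupp.mem_support_iff.2 hj)
  have hk1 : (k : ℕ) + 1 + 1 ≤ lastPos ε := hle ⟨k + 1, hkn⟩ hpos.ne'
  refine (Finset.sup_lt_iff (by simpa using (by omega : 0 < lastPos ε))).2 fun i hi => ?_
  have hi' : (if i < k then ε i else if h : (i : ℕ) + 1 < n then ε ⟨i + 1, h⟩ else 0) ≠ 0 :=
    Finsupp.mem_support_iff.1 hi
  split_ifs at hi' with h1 h2
  · have : (i : ℕ) < k := h1
    omega
  · have h3 : (i : ℕ) + 1 + 1 ≤ lastPos ε := hle ⟨i + 1, h2⟩ hi'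
    omega
  · exact absurd rfl hi'

theorem lastPos_sub_le {n : ℕ} (ν μ : Fin n →₀ ℕ) : lastPos (ν - μ) ≤ lastPos ν :=
  Finset.sup_mono (Finsupp.support_mono tsub_le_self)

/-- The polynomials `G_ε`: `G_{α0^*} = F_α` for a composition `α`, and
`G_{w0aβ0^*} = G_{waβ0^*} - x_k G_{w(a-1)β0^*}`, where `k` is the position of the displayed zero,
`a > 0`, and `β` is a composition. -/
noncomputable def polyG {n : ℕ} (ε : Fin n →₀ ℕ) : MvPolynomial (Fin n) ℚ :=
  if h : (gaps ε).Nonempty then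
    polyG (removeAt ε ((gaps ε).max' h)) -
      X ((gaps ε).max' h) *
        polyG (removeAt ε ((gaps ε).max' h) - Finsupp.single ((gaps ε).max' h) 1)
  else fundamentalQSym n (comp ε)
termination_by lastPos ε
decreasing_by
  · exact lastPos_removeAt_lt ε _ (Finset.max'_mem _ h)
  · exact (lastPos_sub_le _ _).trans_lt (lastPos_removeAt_lt ε _ (Finset.max'_mem _ h))

/-- A subset `S` of an ideal `I` is a Gröbner basis of `I` for the monomial order `m` if the leading
terms of the elements of `S` generate the ideal of leading terms of `I` (`S` may be infinite). -/
def IsGroebnerBasis {n : ℕ} (m : MonomialOrder (Fin n)) (S : Set (MvPolynomial (Fin n) ℚ))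
    (I : Ideal (MvPolynomial (Fin n) ℚ)) : Prop :=
  S ⊆ (I : Set (MvPolynomial (Fin n) ℚ)) ∧
    Ideal.span (m.leadingTerm '' (I : Set (MvPolynomial (Fin n) ℚ))) =
      Ideal.span (m.leadingTerm '' S)

end QuasiSym

/-! Everything follows from two facts about leading exponents for the graded lexicographic order:
`X^ε` is the leading term of `G_ε`, and the leading exponent of a nonzero element of `J_n` is
transdiagonal. As `G_ε ∈ J_n` for `ε` transdiagonal (`polyG_mem_idealJ`), the leading exponents of
`J_n` are exactly the transdiagonal vectors. Triangularity then gives the basis of `J_n`, the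
complementary Dyck monomials in the quotient, and the Gröbner property.

The first fact comes from expanding in the first variable (`coeff_finSuccEquiv_polyG`): the part of
`G_{aε}` of degree at least `a` in `x_1` is exactly `x_1^a G_ε`. Iteration gives the lexicographic
leading term, and homogeneity makes it the graded one.

The second fact (`isTransdiagonal_of_leading`) is an induction on the number of variables. Setting a
variable of a quasi-symmetric polynomial to zero gives the same result for every variable. So the
operator `P ↦ (P(…,x_i,0,…) - P(…,0,x_i,…))/x_i` kills the generators of the ideal, and a twisted
Leibniz rule shows that it maps `J_{n+1}` to `J_n` (`exists_mem_idealJ_X_mul_eq`). A nonzero Dyck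
vector starts with `0`, hence has a zero followed by a positive entry. Applied there, the operator
deletes that zero and lowers the next entry by one, which preserves the Dyck condition, so a Dyck
leading exponent would descend until no variable is left. -/

namespace QuasiSym

open scoped MonomialOrder

/-! ### Refinement of compositions as inclusion of sets of partial sums. -/

/-- The set of sums of the initial segments of a list. -/
def prefixSums (l : List ℕ) : Set ℕ := {s | ∃ i, (l.take i).sum = s}

theorem zero_mem_prefixSums (l : List ℕ) : 0 ∈ prefixSums l := ⟨0, by simp⟩

theorem prefixSums_cons (a : ℕ) (l : List ℕ) :
    prefixSums (a :: l) = insert 0 ((a + ·) '' prefixSums l) := by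
  ext s
  constructor
  · rintro ⟨i, rfl⟩
    cases i with
    | zero => simp
    | succ i => exact Or.inr ⟨_, ⟨i, rfl⟩, by simp⟩
  · rintro (rfl | ⟨_, ⟨i, rfl⟩, rfl⟩)
    · exact zero_mem_prefixSums _
    · exact ⟨i + 1, by simp⟩

theorem prefixSums_filter_pos (l : List ℕ) :
    prefixSums (l.filter fun a => 0 < a) = prefixSums l := by
  induction l with
  | nil => rfl
  | cons a l ih =>
    rcases Nat.eq_zero_or_pos a with rfl | h
    · simp [prefixSums_cons, ih, zero_mem_prefixSums]
    · simp [h, prefixSums_cons, ih]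

theorem mem_boundaries_iff {d : ℕ} (α : Composition d) (s : Fin (d + 1)) :
    s ∈ α.boundaries ↔ (s : ℕ) ∈ prefixSums α.blocks := by
  simp only [Composition.boundaries, Finset.mem_map, Finset.mem_univ, true_and]
  constructor
  · rintro ⟨i, rfl⟩
    exact ⟨i, rfl⟩
  · rintro ⟨i, hi⟩
    rcases lt_or_ge i (α.length + 1) with h | h
    · exact ⟨⟨i, h⟩, Fin.ext hi⟩
    -- Taking more blocks than there are gives the total `d`, the last boundary.
    · refine ⟨Fin.last _, Fin.ext ?_⟩
      rw [← hi, List.take_of_length_le (by simpa using (by omega : α.length ≤ i)), α.blocks_sum]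
      simp

theorem boundaries_subset_iff {d : ℕ} (α β : Composition d) :
    α.boundaries ⊆ β.boundaries ↔ prefixSums α.blocks ⊆ prefixSums β.blocks := by
  constructor
  · rintro h s ⟨i, rfl⟩
    have := h ((mem_boundaries_iff α ⟨α.sizeUpTo i, Nat.lt_succ_of_le (α.sizeUpTo_le i)⟩).2
      ⟨i, rfl⟩)
    exact (mem_boundaries_iff β _).1 this
  · intro h s hs
    exact (mem_boundaries_iff β s).2 (h ((mem_boundaries_iff α s).1 hs))

/-- The set of partial sums of a vector. -/
def vecSums {n : ℕ} (ν : Fin n →₀ ℕ) : Set ℕ := prefixSums (List.ofFn fun i => ν i)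

theorem prefixSums_comp {n : ℕ} (ν : Fin n →₀ ℕ) : prefixSums (comp ν).blocks = vecSums ν :=
  prefixSums_filter_pos _

theorem zero_mem_vecSums {n : ℕ} (ν : Fin n →₀ ℕ) : 0 ∈ vecSums ν := zero_mem_prefixSums _

theorem vecSums_cons {n : ℕ} (a : ℕ) (ν : Fin n →₀ ℕ) :
    vecSums (ν.cons a) = insert 0 ((a + ·) '' vecSums ν) := by
  simp [vecSums, List.ofFn_succ, prefixSums_cons]

theorem sum_cons {n : ℕ} (a : ℕ) (ν : Fin n →₀ ℕ) : ∑ i, ν.cons a i = a + ∑ i, ν i := by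
  simp [Fin.sum_univ_succ]

theorem vecSums_cons_zero {n : ℕ} (ν : Fin n →₀ ℕ) : vecSums (ν.cons 0) = vecSums ν := by
  simp [vecSums_cons, zero_mem_vecSums]

/-- Both sides have the extra element `0`, and it can be dropped: as `a > 0`, no `a + s` equals `0`.
-/
theorem vecSums_cons_subset_iff {m n a c : ℕ} (ha : 0 < a) (ε : Fin m →₀ ℕ) (ν : Fin n →₀ ℕ) :
    vecSums (ε.cons a) ⊆ vecSums (ν.cons c) ↔ (a + ·) '' vecSums ε ⊆ (c + ·) '' vecSums ν := by
  rw [vecSums_cons, vecSums_cons]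
  constructor
  · rintro h _ ⟨s, hs, rfl⟩
    rcases h (Or.inr ⟨s, hs, rfl⟩) with h0 | h0
    · simp only at h0
      omega
    · exact h0
  · exact fun h => Set.insert_subset_insert h

/-! ### Coefficients of the fundamental quasi-symmetric polynomials. -/

theorem coeff_monomialQSym {n d : ℕ} (α : Composition d) (ν : Fin n →₀ ℕ) :
    coeff ν (monomialQSym n α) =
      if ∑ i, ν i = d ∧ (comp ν).blocks = α.blocks then 1 else 0 := by
  classical
  simp only [monomialQSym, coeff_sum, coeff_monomial]
  rw [Finset.sum_ite_eq']
  simp [Finset.mem_finsuppAntidiag]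

-- Only `β = c(ν)` contributes to the coefficient of `X^ν`, and erasing zeros does not change the
-- set of partial sums. Refinement is thus tested on `ν` itself.
open Classical in
theorem coeff_fundamentalQSym {n d : ℕ} (α : Composition d) (ν : Fin n →₀ ℕ) :
    coeff ν (fundamentalQSym n α) =
      if ∑ i, ν i = d ∧ prefixSums α.blocks ⊆ vecSums ν then 1 else 0 := by
  simp only [fundamentalQSym, coeff_sum, coeff_monomialQSym]
  by_cases hd : ∑ i, ν i = d
  · subst hd
    simp only [true_and, ← Composition.ext_iff]
    rw [Finset.sum_ite_eq]
    simp [boundaries_subset_iff, prefixSums_comp]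
  · simp [hd]

open Classical in
theorem coeff_fundamentalQSym_comp {m n : ℕ} (ε : Fin m →₀ ℕ) (ν : Fin n →₀ ℕ) :
    coeff ν (fundamentalQSym n (comp ε)) =
      if ∑ i, ν i = ∑ i, ε i ∧ vecSums ε ⊆ vecSums ν then 1 else 0 := by
  rw [coeff_fundamentalQSym, prefixSums_comp]

theorem isQuasiSymmetric_fundamentalQSym (n : ℕ) {d : ℕ} (α : Composition d) :
    IsQuasiSymmetric (fundamentalQSym n α) := by
  classical
  intro ν μ h
  have h1 : ∑ i, ν i = ∑ i, μ i := by rw [← (comp ν).blocks_sum, h, (comp μ).blocks_sum]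
  rw [coeff_fundamentalQSym, coeff_fundamentalQSym, ← prefixSums_comp, h, prefixSums_comp, h1]

theorem isHomogeneous_fundamentalQSym (n : ℕ) {d : ℕ} (α : Composition d) :
    (fundamentalQSym n α).IsHomogeneous d := by
  classical
  intro ν hν
  rw [coeff_fundamentalQSym] at hν
  split_ifs at hν with h
  · simpa [Finsupp.weight_apply, Finsupp.sum_fintype] using h.1
  · exact absurd rfl hν

/-! ### Unfolding the recursion for `G_ε`. -/

theorem mem_gaps_iff {n : ℕ} {ε : Fin n →₀ ℕ} {k : Fin n} :
    k ∈ gaps ε ↔ ε k = 0 ∧ ∃ h : (k : ℕ) + 1 < n, 0 < ε ⟨k + 1, h⟩ := by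
  simp [gaps]

theorem polyG_of_gaps_eq_empty {n : ℕ} {ε : Fin n →₀ ℕ} (h : gaps ε = ∅) :
    polyG ε = fundamentalQSym n (comp ε) := by
  rw [polyG, dif_neg (by simp [h])]

theorem polyG_of_isGreatest {n : ℕ} {ε : Fin n →₀ ℕ} {k : Fin n}
    (hk : IsGreatest (gaps ε : Set (Fin n)) k) :
    polyG ε = polyG (removeAt ε k) - X k * polyG (removeAt ε k - Finsupp.single k 1) := by
  have hne : (gaps ε).Nonempty := ⟨k, hk.1⟩
  obtain rfl : (gaps ε).max' hne = k := (Finset.isGreatest_max' _ hne).unique hk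
  rw [polyG, dif_pos hne]

/-- The induction principle given by the recursive definition of `polyG`. -/
theorem polyG_induction {n : ℕ} {p : (Fin n →₀ ℕ) → Prop}
    (base : ∀ ε, gaps ε = ∅ → p ε)
    (step : ∀ ε k, IsGreatest (gaps ε : Set (Fin n)) k → p (removeAt ε k) →
      p (removeAt ε k - Finsupp.single k 1) → p ε) (ε : Fin n →₀ ℕ) : p ε := by
  induction h : lastPos ε using Nat.strong_induction_on generalizing ε with
  | _ N ih =>
    subst h
    rcases (gaps ε).eq_empty_or_nonempty with h0 | h0
    · exact base ε h0
    · have hk := Finset.isGreatest_max' _ h0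
      exact step ε _ hk (ih _ (lastPos_removeAt_lt ε _ hk.1) _ rfl)
        (ih _ ((lastPos_sub_le _ _).trans_lt (lastPos_removeAt_lt ε _ hk.1)) _ rfl)

/-! ### Partial sums and the Dyck condition. -/

/-- The entries of a vector, continued by zeros. -/
def entry {n : ℕ} (ν : Fin n →₀ ℕ) (i : ℕ) : ℕ := if h : i < n then ν ⟨i, h⟩ else 0

/-- The sum of the first `m` entries of a vector. -/
def partialSum {n : ℕ} (ν : Fin n →₀ ℕ) (m : ℕ) : ℕ := ∑ i ∈ Finset.range m, entry ν i

@[simp] theorem entry_val {n : ℕ} (ν : Fin n →₀ ℕ) (i : Fin n) : entry ν i = ν i := by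
  simp [entry]

theorem entry_of_le {n : ℕ} (ν : Fin n →₀ ℕ) {i : ℕ} (h : n ≤ i) : entry ν i = 0 := by
  simp [entry, h]

theorem ext_entry {n : ℕ} {ν μ : Fin n →₀ ℕ} (h : ∀ i, entry ν i = entry μ i) : ν = μ := by
  ext i
  simpa using h i

@[simp] theorem partialSum_zero {n : ℕ} (ν : Fin n →₀ ℕ) : partialSum ν 0 = 0 := rfl

theorem partialSum_succ {n : ℕ} (ν : Fin n →₀ ℕ) (m : ℕ) :
    partialSum ν (m + 1) = partialSum ν m + entry ν m := Finset.sum_range_succ _ _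

theorem partialSum_mono {n : ℕ} (ν : Fin n →₀ ℕ) : Monotone (partialSum ν) := fun _ _ h =>
  Finset.sum_le_sum_of_subset (Finset.range_mono h)

theorem partialSum_length {n : ℕ} (ν : Fin n →₀ ℕ) : partialSum ν n = ∑ i, ν i := by
  rw [partialSum, Finset.sum_range]
  simp

theorem partialSum_of_le {n : ℕ} (ν : Fin n →₀ ℕ) {m : ℕ} (h : n ≤ m) :
    partialSum ν m = ∑ i, ν i := by
  induction m, h using Nat.le_induction with
  | base => exact partialSum_length ν
  | succ m hm ih => rw [partialSum_succ, ih, entry_of_le ν hm, add_zero]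

theorem isDyck_iff {n : ℕ} (ν : Fin n →₀ ℕ) : IsDyck ν ↔ ∀ m, partialSum ν (m + 1) ≤ m := by
  have key : ∀ i : Fin n, ∑ j ∈ Finset.Iic i, ν j = partialSum ν (i + 1) := by
    intro i
    rw [partialSum, Nat.range_succ_eq_Iic, ← Fin.map_valEmbedding_Iic, Finset.sum_map]
    simp
  have h1 : IsDyck ν ↔ ∀ i : Fin n, partialSum ν (i + 1) ≤ i := by
    constructor
    · intro h i
      rw [← key]
      exact h (∑ j ∈ Finset.Iic i, ν j, (i : ℕ)) (List.mem_cons_of_mem _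
        (List.mem_flatMap.2 ⟨i, List.mem_finRange i, by simp⟩))
    · intro h p hp
      rcases List.mem_cons.1 hp with rfl | hp
      · simp
      obtain ⟨i, -, hi⟩ := List.mem_flatMap.1 hp
      have := h i
      rw [← key] at this
      rcases List.mem_cons.1 hi with rfl | hi
      · exact this
      · rw [List.mem_singleton.1 hi]
        exact this.trans (Nat.le_succ _)
  rw [h1]
  refine ⟨fun h m => ?_, fun h i => h i⟩
  rcases lt_or_ge m n with hm | hm
  · exact h ⟨m, hm⟩
  · rw [partialSum_of_le ν (by omega), ← partialSum_length]
    rcases n with - | n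
    · simp
    · exact (h (Fin.last n)).trans (by simpa using (by omega : n ≤ m))

theorem isTransdiagonal_iff {n : ℕ} (ν : Fin n →₀ ℕ) :
    IsTransdiagonal ν ↔ ∃ m, m < partialSum ν (m + 1) := by
  simp [IsTransdiagonal, isDyck_iff]

/-! ### The recursion preserves transdiagonality; membership in the ideal and homogeneity. -/

theorem entry_removeAt {n : ℕ} (ε : Fin n →₀ ℕ) (k : Fin n) (i : ℕ) :
    entry (removeAt ε k) i = if i < k then entry ε i else entry ε (i + 1) := by
  have hk := k.2
  by_cases hi : i < n
  · simp only [entry, removeAt, hi, Finsupp.equivFunOnFinite_symm_apply_apply, dif_pos, Fin.lt_def]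
  · rw [if_neg (by omega), entry_of_le _ (by omega), entry_of_le _ (by omega)]

theorem entry_single {n : ℕ} (k : Fin n) (a i : ℕ) :
    entry (Finsupp.single k a) i = if i = k then a else 0 := by
  classical
  have hk := k.2
  by_cases hi : i < n
  · simp [entry, hi, Finsupp.single_apply, Fin.ext_iff, eq_comm]
  · rw [if_neg (by omega), entry_of_le _ (by omega)]

theorem entry_sub {n : ℕ} (ν μ : Fin n →₀ ℕ) (i : ℕ) :
    entry (ν - μ) i = entry ν i - entry μ i := by
  by_cases hi : i < n <;> simp [entry, hi]

theorem entry_add {n : ℕ} (ν μ : Fin n →₀ ℕ) (i : ℕ) :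
    entry (ν + μ) i = entry ν i + entry μ i := by
  by_cases hi : i < n <;> simp [entry, hi]

theorem partialSum_add {n : ℕ} (ν μ : Fin n →₀ ℕ) (m : ℕ) :
    partialSum (ν + μ) m = partialSum ν m + partialSum μ m := by
  simp [partialSum, entry_add, Finset.sum_add_distrib]

theorem partialSum_single {n : ℕ} (k : Fin n) (a m : ℕ) :
    partialSum (Finsupp.single k a) m = if (k : ℕ) < m then a else 0 := by
  simp [partialSum, entry_single]

theorem partialSum_sub_single {n : ℕ} {ν : Fin n →₀ ℕ} {k : Fin n} (h : 0 < ν k) (m : ℕ) :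
    partialSum (ν - Finsupp.single k 1) m + (if (k : ℕ) < m then 1 else 0) = partialSum ν m := by
  rw [← partialSum_single, ← partialSum_add, tsub_add_cancel_of_le]
  simpa using Nat.succ_le_of_lt h

theorem mem_gaps_iff_entry {n : ℕ} {ε : Fin n →₀ ℕ} {k : Fin n} :
    k ∈ gaps ε ↔ entry ε k = 0 ∧ 0 < entry ε (k + 1) := by
  rw [mem_gaps_iff, entry_val]
  refine and_congr_right fun _ => ⟨fun ⟨h, h'⟩ => by simpa [entry, h] using h', fun h => ?_⟩
  by_cases hk : (k : ℕ) + 1 < n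
  · exact ⟨hk, by simpa [entry, hk] using h⟩
  · rw [entry_of_le _ (by omega)] at h
    omega

theorem partialSum_removeAt {n : ℕ} {ε : Fin n →₀ ℕ} {k : Fin n} (hk : entry ε k = 0) (m : ℕ) :
    partialSum (removeAt ε k) m = if m ≤ k then partialSum ε m else partialSum ε (m + 1) := by
  induction m with
  | zero => simp
  | succ m ih =>
    rw [partialSum_succ, ih, entry_removeAt]
    rcases lt_trichotomy m k with h | h | h
    · rw [if_pos h.le, if_pos h, if_pos (by omega), partialSum_succ]
    · rw [if_pos h.le, if_neg (by omega), if_neg (by omega), partialSum_succ _ (m + 1),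
        partialSum_succ _ m, h, hk, add_zero]
    · rw [if_neg (by omega), if_neg (by omega), if_neg (by omega), partialSum_succ _ (m + 1)]

theorem removeAt_apply_pos {n : ℕ} {ε : Fin n →₀ ℕ} {k : Fin n} (hk : k ∈ gaps ε) :
    0 < removeAt ε k k := by
  rw [← entry_val, entry_removeAt, if_neg (lt_irrefl _)]
  exact (mem_gaps_iff_entry.1 hk).2

theorem sum_removeAt {n : ℕ} {ε : Fin n →₀ ℕ} {k : Fin n} (hk : k ∈ gaps ε) :
    ∑ i, removeAt ε k i = ∑ i, ε i := by
  rw [← partialSum_length, partialSum_removeAt (mem_gaps_iff_entry.1 hk).1,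
    if_neg (by omega), partialSum_of_le _ (by omega)]

theorem sum_removeAt_sub {n : ℕ} {ε : Fin n →₀ ℕ} {k : Fin n} (hk : k ∈ gaps ε) :
    ∑ i, (removeAt ε k - Finsupp.single k 1 : Fin n →₀ ℕ) i + 1 = ∑ i, ε i := by
  have h := partialSum_sub_single (removeAt_apply_pos hk) n
  rwa [partialSum_length, partialSum_length, if_pos k.2, sum_removeAt hk] at h

/-- A crossing of the diagonal before position `k` is untouched. A later one moves one position to
the left, and this gain of one makes up for the unit subtracted. -/
theorem isTransdiagonal_removeAt {n : ℕ} {ε : Fin n →₀ ℕ} {k : Fin n} (hk : k ∈ gaps ε)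
    (hε : IsTransdiagonal ε) : IsTransdiagonal (removeAt ε k) ∧
      IsTransdiagonal (removeAt ε k - Finsupp.single k 1) := by
  obtain ⟨hk0, hk1⟩ := mem_gaps_iff_entry.1 hk
  simp only [isTransdiagonal_iff] at hε ⊢
  obtain ⟨m, hm⟩ := hε
  have hsub := partialSum_sub_single (removeAt_apply_pos hk)
  have hrem := partialSum_removeAt hk0
  -- The decremented vector has the smaller partial sums, so its crossing serves for both.
  suffices ∃ m, m < partialSum (removeAt ε k - Finsupp.single k 1) (m + 1) by
    refine ⟨?_, this⟩
    obtain ⟨m, hm⟩ := this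
    exact ⟨m, by have := hsub (m + 1); omega⟩
  rcases lt_trichotomy m k with h | h | h
  · refine ⟨m, ?_⟩
    have h1 := hsub (m + 1)
    rw [if_neg (by omega), hrem, if_pos (by omega)] at h1
    omega
  -- The entry at `k` is zero, so the path was already past the diagonal one position earlier.
  · rw [partialSum_succ, h, hk0, add_zero] at hm
    obtain ⟨k', hk'⟩ : ∃ k', (k : ℕ) = k' + 1 := by
      refine Nat.exists_eq_succ_of_ne_zero fun h0 => ?_
      rw [h0] at hm
      simp at hm
    refine ⟨k', ?_⟩
    have h1 := hsub (k' + 1)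
    rw [if_neg (by omega), hrem, if_pos (by omega)] at h1
    rw [hk'] at hm
    omega
  · obtain ⟨m, rfl⟩ := Nat.exists_eq_succ_of_ne_zero (by omega : m ≠ 0)
    refine ⟨m, ?_⟩
    have h1 := hsub (m + 1)
    rw [if_pos (by omega), hrem, if_neg (by omega)] at h1
    simp only [Nat.succ_eq_add_one] at hm
    omega

theorem constantCoeff_fundamentalQSym {n : ℕ} {d : ℕ} (α : Composition d) (hd : d ≠ 0) :
    constantCoeff (fundamentalQSym n α) = 0 := by
  classical
  rw [constantCoeff_eq, coeff_fundamentalQSym, if_neg]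
  rintro ⟨h, -⟩
  exact hd (by simpa using h.symm)

theorem polyG_mem_idealJ {n : ℕ} (ε : Fin n →₀ ℕ) (hε : IsTransdiagonal ε) :
    polyG ε ∈ idealJ n := by
  induction ε using polyG_induction with
  | base ε h =>
    rw [polyG_of_gaps_eq_empty h]
    refine Ideal.subset_span ⟨isQuasiSymmetric_fundamentalQSym n _,
      constantCoeff_fundamentalQSym _ fun h0 => ?_⟩
    obtain ⟨m, hm⟩ := (isTransdiagonal_iff ε).1 hε
    have := partialSum_mono ε (le_max_left (m + 1) n)
    rw [partialSum_of_le ε (le_max_right _ _), h0] at this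
    omega
  | step ε k hk h1 h2 =>
    obtain ⟨h3, h4⟩ := isTransdiagonal_removeAt hk.1 hε
    rw [polyG_of_isGreatest hk]
    exact sub_mem (h1 h3) (Ideal.mul_mem_left _ _ (h2 h4))

theorem isHomogeneous_polyG {n : ℕ} (ε : Fin n →₀ ℕ) : (polyG ε).IsHomogeneous (∑ i, ε i) := by
  induction ε using polyG_induction with
  | base ε h =>
    rw [polyG_of_gaps_eq_empty h]
    exact isHomogeneous_fundamentalQSym n _
  | step ε k hk h1 h2 =>
    rw [polyG_of_isGreatest hk]
    rw [sum_removeAt hk.1] at h1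
    refine h1.sub ?_
    rw [← sum_removeAt_sub hk.1, add_comm]
    exact (isHomogeneous_X _ _).mul h2

/-! ### Expansion of `G_ε` in the first variable. -/

@[simp] theorem entry_cons_zero {n : ℕ} (a : ℕ) (ε : Fin n →₀ ℕ) : entry (ε.cons a) 0 = a := by
  simp [entry]

@[simp] theorem entry_cons_succ {n : ℕ} (a : ℕ) (ε : Fin n →₀ ℕ) (i : ℕ) :
    entry (ε.cons a) (i + 1) = entry ε i := by
  by_cases h : i < n
  · rw [entry, dif_pos (Nat.succ_lt_succ h), entry, dif_pos h]
    exact Finsupp.cons_succ ⟨i, h⟩ a ε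
  · rw [entry_of_le _ (by omega), entry_of_le _ (by omega)]

theorem partialSum_cons_succ {n : ℕ} (a : ℕ) (ε : Fin n →₀ ℕ) (m : ℕ) :
    partialSum (ε.cons a) (m + 1) = a + partialSum ε m := by
  rw [partialSum, Finset.sum_range_succ']
  simp [partialSum, add_comm]

theorem vecSums_eq_range {n : ℕ} (ν : Fin n →₀ ℕ) : vecSums ν = Set.range (partialSum ν) := by
  induction n with
  | zero =>
    have : ∀ m, partialSum ν m = 0 := fun m => by
      rw [partialSum_of_le ν (Nat.zero_le m), Finset.univ_eq_empty, Finset.sum_empty]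
    ext s
    simp [vecSums, prefixSums, this, eq_comm]
  | succ n ih =>
    rw [← Finsupp.cons_tail ν, vecSums_cons, ih]
    ext s
    constructor
    · rintro (rfl | ⟨_, ⟨m, rfl⟩, rfl⟩)
      · exact ⟨0, rfl⟩
      · exact ⟨m + 1, partialSum_cons_succ _ _ _⟩
    · rintro ⟨m, rfl⟩
      cases m with
      | zero => exact Or.inl rfl
      | succ m => exact Or.inr ⟨_, ⟨m, rfl⟩, (partialSum_cons_succ _ _ _).symm⟩

theorem removeAt_cons_succ {n : ℕ} (a : ℕ) (ε : Fin n →₀ ℕ) (k : Fin n) :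
    removeAt (ε.cons a) k.succ = (removeAt ε k).cons a := by
  refine ext_entry fun i => ?_
  cases i <;> simp [entry_removeAt]

theorem cons_sub_single_succ {n : ℕ} (a : ℕ) (ε : Fin n →₀ ℕ) (k : Fin n) :
    ε.cons a - Finsupp.single k.succ 1 = (ε - Finsupp.single k 1).cons a := by
  refine ext_entry fun i => ?_
  cases i <;> simp [entry_sub, entry_single]

theorem cons_sub_single_zero {n : ℕ} (a : ℕ) (ε : Fin n →₀ ℕ) :
    ε.cons a - Finsupp.single 0 1 = ε.cons (a - 1) := by
  refine ext_entry fun i => ?_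
  cases i <;> simp [entry_sub, entry_single]

theorem succ_mem_gaps_cons {n : ℕ} {a : ℕ} {ε : Fin n →₀ ℕ} {k : Fin n} :
    k.succ ∈ gaps (ε.cons a) ↔ k ∈ gaps ε := by
  simp [mem_gaps_iff_entry]

theorem zero_mem_gaps_cons {n : ℕ} {a : ℕ} {ε : Fin n →₀ ℕ} :
    0 ∈ gaps (ε.cons a) ↔ a = 0 ∧ 0 < entry ε 0 := by
  simp [mem_gaps_iff_entry]

theorem isGreatest_gaps_cons {n : ℕ} (a : ℕ) {ε : Fin n →₀ ℕ} {k : Fin n}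
    (hk : IsGreatest (gaps ε : Set (Fin n)) k) :
    IsGreatest (gaps (ε.cons a) : Set (Fin (n + 1))) k.succ := by
  refine ⟨succ_mem_gaps_cons.2 hk.1, fun j hj => ?_⟩
  cases j using Fin.cases with
  | zero => exact Fin.zero_le _
  | succ j => exact Fin.succ_le_succ_iff.2 (hk.2 (succ_mem_gaps_cons.1 hj))

theorem gaps_eq_empty_iff {n : ℕ} {ε : Fin n →₀ ℕ} :
    gaps ε = ∅ ↔ ∀ i, entry ε i = 0 → entry ε (i + 1) = 0 := by
  constructor
  · intro h i hi
    by_contra h0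
    have hin : i < n := by
      by_contra hn
      exact h0 (entry_of_le _ (by omega))
    have : (⟨i, hin⟩ : Fin n) ∈ gaps ε := mem_gaps_iff_entry.2 ⟨hi, Nat.pos_of_ne_zero h0⟩
    simp [h] at this
  · intro h
    refine Finset.eq_empty_of_forall_notMem fun k hk => ?_
    obtain ⟨h1, h2⟩ := mem_gaps_iff_entry.1 hk
    exact h2.ne' (h k h1)

theorem eq_zero_of_gaps_eq_empty {n : ℕ} {ε : Fin n →₀ ℕ} (h : gaps ε = ∅) (h0 : entry ε 0 = 0) :
    ε = 0 := by
  rw [gaps_eq_empty_iff] at h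
  have key : ∀ i, entry ε i = 0 := by
    intro i
    induction i with
    | zero => exact h0
    | succ i ih => exact h i ih
  refine ext_entry fun i => (key i).trans ?_
  simp [entry]

/-- For `x_1^c X^ν` to occur, `a` must be `c` plus a partial sum of `ν`, which forces `c = a`; the
condition on the rest is then the one for `ε`. -/
theorem coeff_finSuccEquiv_fundamentalQSym {n : ℕ} {a c : ℕ} (ha : 0 < a) (hc : a ≤ c)
    (ε : Fin n →₀ ℕ) :
    (finSuccEquiv ℚ n (fundamentalQSym (n + 1) (comp (ε.cons a)))).coeff c =
      if c = a then fundamentalQSym n (comp ε) else 0 := by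
  classical
  ext ν
  rw [finSuccEquiv_coeff_coeff, coeff_fundamentalQSym_comp, vecSums_cons_subset_iff ha]
  split_ifs with h1 h2 h2
  · subst h2
    obtain ⟨h3, h4⟩ := h1
    rw [coeff_fundamentalQSym_comp, if_pos]
    rw [sum_cons, sum_cons] at h3
    exact ⟨by omega, (Set.image_subset_image_iff (add_right_injective c)).1 h4⟩
  · obtain ⟨s, -, hs⟩ := h1.2 ⟨0, zero_mem_vecSums ε, rfl⟩
    simp only at hs
    omega
  · subst h2
    rw [coeff_fundamentalQSym_comp, if_neg]
    rintro ⟨h3, h4⟩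
    refine h1 ⟨?_, Set.image_mono h4⟩
    rw [sum_cons, sum_cons, h3]
  · simp

theorem polyG_zero (n : ℕ) : polyG (0 : Fin n →₀ ℕ) = 1 := by
  classical
  have h0 : gaps (0 : Fin n →₀ ℕ) = ∅ := by
    rw [gaps_eq_empty_iff]
    simp [entry]
  rw [polyG_of_gaps_eq_empty h0]
  ext ν
  rw [coeff_fundamentalQSym_comp, coeff_one]
  refine if_congr ?_ rfl rfl
  constructor
  · rintro ⟨h, -⟩
    ext i
    simp only [Finsupp.coe_zero, Pi.zero_apply, Finset.sum_const_zero,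
      Finset.sum_eq_zero_iff, Finset.mem_univ, true_implies] at h
    exact (h i).symm
  · rintro rfl
    simp

/-- Removing the first zero of `0ε` when `ε` has no gap: only the terms in which the first
variable does not occur remain. -/
theorem coeff_finSuccEquiv_polyG_cons_zero {n : ℕ} {ε : Fin n →₀ ℕ} (hε : gaps ε = ∅)
    (hpos : 0 < entry ε 0)
    (ih : ∀ (b : ℕ) (τ : Fin n →₀ ℕ), removeAt (ε.cons 0) 0 = τ.cons (b + 1) → ∀ c, b ≤ c →
      (finSuccEquiv ℚ n (polyG (τ.cons b))).coeff c = if c = b then polyG τ else 0) (c : ℕ) :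
    (finSuccEquiv ℚ n (polyG (ε.cons 0))).coeff c = if c = 0 then polyG ε else 0 := by
  classical
  have hmax : IsGreatest (gaps (ε.cons 0) : Set (Fin (n + 1))) 0 := by
    refine ⟨zero_mem_gaps_cons.2 ⟨rfl, hpos⟩, fun j hj => ?_⟩
    cases j using Fin.cases with
    | zero => exact le_rfl
    | succ j =>
      have := succ_mem_gaps_cons.1 hj
      simp [hε] at this
  set ρ := removeAt (ε.cons 0) 0 with hρdef
  -- `ρ` is `ε` followed by a zero, so it has no gap and its `G` is a fundamental polynomial.
  have hent : ∀ i, entry ρ i = entry ε i := fun i => by simp [hρdef, entry_removeAt]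
  have hρgap : gaps ρ = ∅ := by
    rw [gaps_eq_empty_iff] at hε ⊢
    simpa only [hent] using hε
  have hpart : partialSum ρ = partialSum ε := by
    funext m
    simp [partialSum, hent]
  have hsum : ∑ i, ρ i = ∑ i, ε i := by
    rw [← partialSum_of_le ρ le_rfl, hpart, partialSum_of_le ε (Nat.le_succ n)]
  obtain ⟨b, hb⟩ : ∃ b, entry ρ 0 = b + 1 :=
    Nat.exists_eq_succ_of_ne_zero (by rw [hent]; omega)
  obtain ⟨τ, hτ⟩ : ∃ τ : Fin n →₀ ℕ, ρ = τ.cons (b + 1) := by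
    refine ⟨ρ.tail, ?_⟩
    rw [← hb, show entry ρ 0 = ρ 0 from entry_val ρ 0, Finsupp.cons_tail]
  have hτgap : gaps τ = ∅ := by
    refine Finset.eq_empty_of_forall_notMem fun k hk => ?_
    have := succ_mem_gaps_cons (a := b + 1).2 hk
    rw [← hτ, hρgap] at this
    simp at this
  rw [polyG_of_isGreatest hmax, ← hρdef, map_sub, map_mul, finSuccEquiv_X_zero,
    Polynomial.coeff_sub, polyG_of_gaps_eq_empty hρgap]
  -- In degree `0` in `x_1` the subtracted product vanishes. In degree `c + 1`, the coefficient of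
  -- `F_{(b+1)τ}` must cancel the coefficient of `x_1^c` in `G_{bτ}`.
  rcases c with - | c
  · rw [Polynomial.coeff_X_mul_zero, sub_zero, if_pos rfl, polyG_of_gaps_eq_empty hε]
    ext ν
    rw [finSuccEquiv_coeff_coeff, coeff_fundamentalQSym_comp, coeff_fundamentalQSym_comp,
      vecSums_cons_zero, sum_cons, zero_add, hsum, vecSums_eq_range ρ, hpart, ← vecSums_eq_range]
  · rw [Polynomial.coeff_X_mul, if_neg (Nat.succ_ne_zero c), hτ, cons_sub_single_zero,
      Nat.add_sub_cancel, sub_eq_zero]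
    -- For `b = 0`, `0τ` may have a gap, so the inductive hypothesis is needed. For `b > 0` both
    -- sides are fundamental, and their conditions on partial sums differ by a shift by `1`.
    rcases Nat.eq_zero_or_pos b with rfl | hbpos
    · rw [coeff_finSuccEquiv_fundamentalQSym (Nat.succ_pos 0) (Nat.succ_le_succ (Nat.zero_le c)), ih 0 τ hτ c (Nat.zero_le c),
        polyG_of_gaps_eq_empty hτgap]
      simp
    · have hgap : gaps (τ.cons b) = ∅ := by
        refine Finset.eq_empty_of_forall_notMem fun k hk => ?_
        cases k using Fin.cases with
        | zero => exact hbpos.ne' (zero_mem_gaps_cons.1 hk).1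
        | succ k =>
          have := succ_mem_gaps_cons.1 hk
          simp [hτgap] at this
      rw [polyG_of_gaps_eq_empty hgap]
      ext ν
      rw [finSuccEquiv_coeff_coeff, finSuccEquiv_coeff_coeff, coeff_fundamentalQSym_comp,
        coeff_fundamentalQSym_comp, vecSums_cons_subset_iff (Nat.succ_pos b),
        vecSums_cons_subset_iff hbpos]
      refine if_congr (and_congr ?_ ?_) rfl rfl
      · simp only [sum_cons]
        omega
      · have himg : ∀ (m : ℕ) (S : Set ℕ), ((m + 1) + ·) '' S = (1 + ·) '' ((m + ·) '' S) := by
          intro m S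
          rw [Set.image_image]
          refine Set.image_congr' fun s => ?_
          omega
        rw [himg b, himg c, Set.image_subset_image_iff (add_right_injective 1)]

/-- If `ε` has a gap, the last gap of `aε` lies in `ε`, so the recursion does not involve `x_1` and
commutes with taking coefficients. Otherwise `aε` is treated directly: it is zero, or has no gap, or
has its only gap in front. -/
theorem coeff_finSuccEquiv_polyG {n : ℕ} (a : ℕ) (ε : Fin n →₀ ℕ) (c : ℕ) (hc : a ≤ c) :
    (finSuccEquiv ℚ n (polyG (ε.cons a))).coeff c = if c = a then polyG ε else 0 := by
  induction h : lastPos (ε.cons a) using Nat.strong_induction_on generalizing a ε c with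
  | _ N ih =>
    subst h
    rcases (gaps ε).eq_empty_or_nonempty with h0 | h0
    · rcases Nat.eq_zero_or_pos a with rfl | ha
      · rcases Nat.eq_zero_or_pos (entry ε 0) with he | he
        · obtain rfl := eq_zero_of_gaps_eq_empty h0 he
          rw [Finsupp.cons_zero_zero, polyG_zero, polyG_zero, map_one, Polynomial.coeff_one]
        · refine coeff_finSuccEquiv_polyG_cons_zero h0 he (fun b τ hτ c hc => ?_) c
          refine ih _ ?_ _ _ _ hc rfl
          have h1 := lastPos_removeAt_lt (ε.cons 0) 0 (zero_mem_gaps_cons.2 ⟨rfl, he⟩)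
          refine lt_of_le_of_lt ?_ h1
          rw [hτ]
          have := lastPos_sub_le (τ.cons (b + 1)) (Finsupp.single 0 1)
          rwa [cons_sub_single_zero, Nat.add_sub_cancel] at this
      · have hgap : gaps (ε.cons a) = ∅ := by
          refine Finset.eq_empty_of_forall_notMem fun k hk => ?_
          cases k using Fin.cases with
          | zero => exact ha.ne' (zero_mem_gaps_cons.1 hk).1
          | succ k =>
            have := succ_mem_gaps_cons.1 hk
            simp [h0] at this
        rw [polyG_of_gaps_eq_empty hgap, polyG_of_gaps_eq_empty h0,
          coeff_finSuccEquiv_fundamentalQSym ha hc]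
    · have hk := Finset.isGreatest_max' _ h0
      have hk' := isGreatest_gaps_cons a hk
      have hlt := lastPos_removeAt_lt _ _ hk'.1
      have hlt' := (lastPos_sub_le _ (Finsupp.single ((gaps ε).max' h0).succ 1)).trans_lt hlt
      rw [removeAt_cons_succ] at hlt hlt'
      rw [cons_sub_single_succ] at hlt'
      rw [polyG_of_isGreatest hk', polyG_of_isGreatest hk, removeAt_cons_succ,
        cons_sub_single_succ, map_sub, map_mul, finSuccEquiv_X_succ, Polynomial.coeff_sub,
        Polynomial.coeff_C_mul, ih _ hlt _ _ _ hc rfl, ih _ hlt' _ _ _ hc rfl]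
      split_ifs <;> simp

/-! ### The leading term of `G_ε`. -/

theorem toLex_cons_lt_cons {n : ℕ} {a c : ℕ} {ν ε : Fin n →₀ ℕ} (h : c < a) :
    toLex (ν.cons c) < toLex (ε.cons a) :=
  Finsupp.Lex.lt_iff.2 ⟨0, fun j hj => absurd hj (Fin.not_lt_zero j), by simpa using h⟩

theorem toLex_cons_le_cons {n : ℕ} (a : ℕ) {ν ε : Fin n →₀ ℕ} (h : toLex ν ≤ toLex ε) :
    toLex (ν.cons a) ≤ toLex (ε.cons a) := by
  rcases h.eq_or_lt with h | h
  · rw [toLex_inj.1 h]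
  · obtain ⟨i, h1, h2⟩ := Finsupp.Lex.lt_iff.1 h
    refine (Finsupp.Lex.lt_iff.2 ⟨i.succ, fun j hj => ?_, by simpa using h2⟩).le
    cases j using Fin.cases with
    | zero => simp
    | succ j => simpa using h1 j (Fin.succ_lt_succ_iff.1 hj)

theorem coeff_polyG_self {n : ℕ} (ε : Fin n →₀ ℕ) : coeff ε (polyG ε) = 1 := by
  induction n with
  | zero => rw [Subsingleton.elim ε 0, polyG_zero, coeff_one, if_pos rfl]
  | succ n ih =>
    rw [← Finsupp.cons_tail ε, ← finSuccEquiv_coeff_coeff, coeff_finSuccEquiv_polyG _ _ _ le_rfl,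
      if_pos rfl, ih]

theorem toLex_le_of_coeff_polyG_ne_zero {n : ℕ} {ε ν : Fin n →₀ ℕ} (h : coeff ν (polyG ε) ≠ 0) :
    toLex ν ≤ toLex ε := by
  induction n with
  | zero => rw [Subsingleton.elim ν ε]
  | succ n ih =>
    rw [← Finsupp.cons_tail ε, ← Finsupp.cons_tail ν, ← finSuccEquiv_coeff_coeff] at h
    rw [← Finsupp.cons_tail ε, ← Finsupp.cons_tail ν]
    rcases lt_or_ge (ν 0) (ε 0) with h1 | h1
    · exact (toLex_cons_lt_cons h1).le
    · rw [coeff_finSuccEquiv_polyG _ _ _ h1] at h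
      split_ifs at h with h2
      · rw [h2]
        exact toLex_cons_le_cons _ (ih h)
      · simp at h

theorem degLex_le_of_coeff_polyG_ne_zero {n : ℕ} {ε ν : Fin n →₀ ℕ}
    (h : coeff ν (polyG ε) ≠ 0) : ν ≼[MonomialOrder.degLex] ε := by
  rw [MonomialOrder.degLex_le_iff, Finsupp.DegLex.le_iff]
  refine Or.inr ⟨?_, toLex_le_of_coeff_polyG_ne_zero h⟩
  have := isHomogeneous_polyG ε h
  rw [Finsupp.weight_apply, Finsupp.sum_fintype _ _ (by simp)] at this
  simpa [Finsupp.degree_eq_sum] using this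

theorem degree_polyG {n : ℕ} (ε : Fin n →₀ ℕ) : MonomialOrder.degLex.degree (polyG ε) = ε := by
  apply MonomialOrder.degLex.toSyn.injective
  refine le_antisymm ?_ ?_
  · rw [MonomialOrder.degree_le_iff]
    exact fun ν hν => degLex_le_of_coeff_polyG_ne_zero (mem_support_iff.1 hν)
  · exact MonomialOrder.le_degree (mem_support_iff.2 (by simp [coeff_polyG_self]))

theorem leadingCoeff_polyG {n : ℕ} (ε : Fin n →₀ ℕ) :
    MonomialOrder.degLex.leadingCoeff (polyG ε) = 1 := by
  rw [MonomialOrder.leadingCoeff, degree_polyG, coeff_polyG_self]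

/-! ### Inserting a zero into an exponent. -/

/-- Insert a zero at position `p`. -/
noncomputable def insertZero {n : ℕ} (p : Fin (n + 1)) (ν : Fin n →₀ ℕ) : Fin (n + 1) →₀ ℕ :=
  Finsupp.equivFunOnFinite.symm (p.insertNth (α := fun _ => ℕ) 0 ν)

@[simp] theorem insertZero_apply_same {n : ℕ} (p : Fin (n + 1)) (ν : Fin n →₀ ℕ) :
    insertZero p ν p = 0 := by
  simp [insertZero]

@[simp] theorem insertZero_apply_succAbove {n : ℕ} (p : Fin (n + 1)) (ν : Fin n →₀ ℕ)
    (j : Fin n) : insertZero p ν (p.succAbove j) = ν j := by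
  simp [insertZero]

theorem eq_insertZero_iff {n : ℕ} {p : Fin (n + 1)} {ν : Fin n →₀ ℕ} {μ : Fin (n + 1) →₀ ℕ} :
    μ = insertZero p ν ↔ μ p = 0 ∧ ∀ j, μ (p.succAbove j) = ν j := by
  constructor
  · rintro rfl
    simp
  · rintro ⟨h1, h2⟩
    ext j
    rcases Fin.eq_self_or_eq_succAbove p j with rfl | ⟨j, rfl⟩
    · simp [h1]
    · simp [h2]

theorem exists_eq_insertZero {n : ℕ} {p : Fin (n + 1)} {μ : Fin (n + 1) →₀ ℕ} (h : μ p = 0) :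
    ∃ ν, μ = insertZero p ν :=
  ⟨Finsupp.equivFunOnFinite.symm fun j => μ (p.succAbove j),
    eq_insertZero_iff.2 ⟨h, fun _ => rfl⟩⟩

theorem insertZero_zero {n : ℕ} (ν : Fin n →₀ ℕ) : insertZero 0 ν = ν.cons 0 :=
  (eq_insertZero_iff.2 (by simp)).symm

theorem insertZero_succ_cons {n : ℕ} (q : Fin (n + 1)) (a : ℕ) (ν : Fin n →₀ ℕ) :
    insertZero q.succ (ν.cons a) = (insertZero q ν).cons a := by
  refine (eq_insertZero_iff.2 ⟨by simp, fun j => ?_⟩).symm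
  cases j using Fin.cases with
  | zero => simp
  | succ j => simp [Fin.succ_succAbove_succ]

theorem blocks_comp_cons {n : ℕ} (a : ℕ) (ν : Fin n →₀ ℕ) :
    (comp (ν.cons a)).blocks = if 0 < a then a :: (comp ν).blocks else (comp ν).blocks := by
  simp [comp, List.ofFn_succ, List.filter_cons]

theorem blocks_comp_insertZero {n : ℕ} (p : Fin (n + 1)) (ν : Fin n →₀ ℕ) :
    (comp (insertZero p ν)).blocks = (comp ν).blocks := by
  induction n with
  | zero => rw [Subsingleton.elim (α := Fin 1) p 0, insertZero_zero, blocks_comp_cons, if_neg (lt_irrefl 0)]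
  | succ n ih =>
    cases p using Fin.cases with
    | zero => rw [insertZero_zero, blocks_comp_cons, if_neg (lt_irrefl 0)]
    | succ q =>
      rw [← Finsupp.cons_tail ν, insertZero_succ_cons, blocks_comp_cons, blocks_comp_cons, ih]

theorem partialSum_insertZero {n : ℕ} (p : Fin (n + 1)) (ν : Fin n →₀ ℕ) (m : ℕ) :
    partialSum (insertZero p ν) m = if m ≤ p then partialSum ν m else partialSum ν (m - 1) := by
  induction n generalizing m with
  | zero =>
    rw [Subsingleton.elim (α := Fin 1) p 0, insertZero_zero]
    cases m <;> simp [partialSum_cons_succ]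
  | succ n ih =>
    cases p using Fin.cases with
    | zero =>
      rw [insertZero_zero]
      cases m <;> simp [partialSum_cons_succ]
    | succ q =>
      rw [← Finsupp.cons_tail ν, insertZero_succ_cons]
      rcases m with - | m
      · simp
      · rw [partialSum_cons_succ, ih, Fin.val_succ]
        rcases le_or_gt m q with h | h
        · rw [if_pos h, if_pos (by omega), partialSum_cons_succ]
        · obtain ⟨m, rfl⟩ := Nat.exists_eq_succ_of_ne_zero (by omega : m ≠ 0)
          rw [if_neg (by omega), if_neg (by omega), Nat.add_sub_cancel, Nat.succ_sub_one,
            Nat.succ_eq_add_one, partialSum_cons_succ]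

theorem degree_insertZero {n : ℕ} (p : Fin (n + 1)) (ν : Fin n →₀ ℕ) :
    (insertZero p ν).degree = ν.degree := by
  rw [Finsupp.degree_eq_sum, Finsupp.degree_eq_sum, Fin.sum_univ_succAbove _ p]
  simp

theorem insertZero_lt_insertZero {n : ℕ} (p : Fin (n + 1)) {ν μ : Fin n →₀ ℕ}
    (h : ν ≺[MonomialOrder.degLex] μ) :
    insertZero p ν ≺[MonomialOrder.degLex] insertZero p μ := by
  rw [MonomialOrder.degLex_lt_iff, Finsupp.DegLex.lt_iff] at h ⊢
  simp only [ofDegLex_toDegLex, degree_insertZero] at h ⊢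
  refine h.imp_right fun ⟨h1, h2⟩ => ⟨h1, ?_⟩
  obtain ⟨i, h3, h4⟩ := Finsupp.Lex.lt_iff.1 h2
  refine Finsupp.Lex.lt_iff.2 ⟨p.succAbove i, fun j hj => ?_, by simpa using h4⟩
  rcases Fin.eq_self_or_eq_succAbove p j with rfl | ⟨j, rfl⟩
  · simp
  · simpa using h3 j ((Fin.strictMono_succAbove p).lt_iff_lt.1 hj)

theorem insertZero_le_insertZero_iff {n : ℕ} (p : Fin (n + 1)) {ν μ : Fin n →₀ ℕ} :
    insertZero p ν ≼[MonomialOrder.degLex] insertZero p μ ↔ ν ≼[MonomialOrder.degLex] μ := by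
  constructor
  · intro h
    by_contra hlt
    exact (insertZero_lt_insertZero p (not_le.1 hlt)).not_ge h
  · intro h
    rcases h.eq_or_lt with h | h
    · rw [MonomialOrder.degLex.toSyn.injective h]
    · exact (insertZero_lt_insertZero p h).le

/-- The degrees agree, and the vectors first differ at position `i`, with entries `0` and `ν i`. -/
theorem insertZero_castSucc_lt {n : ℕ} (i : Fin n) {ν : Fin n →₀ ℕ} (h : 0 < ν i) :
    insertZero i.castSucc ν ≺[MonomialOrder.degLex] insertZero i.succ ν := by
  rw [MonomialOrder.degLex_lt_iff, Finsupp.DegLex.lt_iff]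
  simp only [ofDegLex_toDegLex, degree_insertZero]
  refine Or.inr ⟨trivial, Finsupp.Lex.lt_iff.2 ⟨i.castSucc, fun j hj => ?_, ?_⟩⟩
  · obtain ⟨j, rfl⟩ : ∃ j' : Fin n, j = j'.castSucc :=
      ⟨j.castPred (Fin.ne_last_of_lt hj), by simp⟩
    have hji : j < i := hj
    have h1 := insertZero_apply_succAbove i.castSucc ν j
    have h2 := insertZero_apply_succAbove i.succ ν j
    rw [Fin.succAbove_of_castSucc_lt _ _ hj] at h1
    rw [Fin.succAbove_of_castSucc_lt _ _ (hj.trans i.castSucc_lt_succ)] at h2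
    simp [h1, h2]
  · have h2 := insertZero_apply_succAbove i.succ ν i
    rw [Fin.succAbove_of_castSucc_lt _ _ i.castSucc_lt_succ] at h2
    simpa [h2] using h

theorem insertZero_castSucc_le {n : ℕ} (i : Fin n) (ν : Fin n →₀ ℕ) :
    insertZero i.castSucc ν ≼[MonomialOrder.degLex] insertZero i.succ ν := by
  rcases Nat.eq_zero_or_pos (ν i) with h | h
  · have : insertZero i.castSucc ν = insertZero i.succ ν := by
      refine eq_insertZero_iff.2 ⟨?_, fun j => ?_⟩
      · rw [← Fin.succAbove_castSucc_self i, insertZero_apply_succAbove, h]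
      · rcases lt_trichotomy j i with hj | rfl | hj
        · rw [Fin.succAbove_of_castSucc_lt _ _
            (lt_trans (Fin.castSucc_lt_castSucc_iff.2 hj) i.castSucc_lt_succ),
            ← Fin.succAbove_of_castSucc_lt i.castSucc j (Fin.castSucc_lt_castSucc_iff.2 hj),
            insertZero_apply_succAbove]
        · rw [Fin.succAbove_of_castSucc_lt _ _ j.castSucc_lt_succ, insertZero_apply_same, h]
        · rw [Fin.succAbove_of_le_castSucc _ _ (Fin.succ_le_castSucc_iff.2 hj),
            ← Fin.succAbove_of_le_castSucc i.castSucc j (Fin.castSucc_le_castSucc_iff.2 hj.le),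
            insertZero_apply_succAbove]
    rw [this]
  · exact (insertZero_castSucc_lt i h).le

/-! ### Setting a variable to zero, difference quotients, and leading exponents of the ideal. -/

/-- Specialize the variable at position `p` to zero, and renumber the others. -/
noncomputable def specializeZero {n : ℕ} (p : Fin (n + 1)) :
    MvPolynomial (Fin (n + 1)) ℚ →ₐ[ℚ] MvPolynomial (Fin n) ℚ :=
  aeval (p.insertNth (α := fun _ => MvPolynomial (Fin n) ℚ) 0 X)

@[simp] theorem specializeZero_X_same {n : ℕ} (p : Fin (n + 1)) :
    specializeZero p (X p) = 0 := by
  simp [specializeZero]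

@[simp] theorem specializeZero_X_succAbove {n : ℕ} (p : Fin (n + 1)) (j : Fin n) :
    specializeZero p (X (p.succAbove j)) = X j := by
  simp [specializeZero]

theorem coeff_specializeZero {n : ℕ} (p : Fin (n + 1)) (P : MvPolynomial (Fin (n + 1)) ℚ)
    (ν : Fin n →₀ ℕ) : coeff ν (specializeZero p P) = coeff (insertZero p ν) P := by
  classical
  induction P using MvPolynomial.induction_on generalizing ν with
  | C a =>
    rw [← algebraMap_eq, AlgHom.commutes, algebraMap_eq, algebraMap_eq, coeff_C, coeff_C]
    refine if_congr ?_ rfl rfl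
    rw [eq_insertZero_iff, Finsupp.ext_iff]
    simp
  | add P Q hP hQ => rw [map_add, coeff_add, coeff_add, hP, hQ]
  | mul_X P j hP =>
    rw [map_mul, coeff_mul_X']
    rcases Fin.eq_self_or_eq_succAbove p j with rfl | ⟨j, rfl⟩
    · simp
    · have : insertZero p ν - Finsupp.single (p.succAbove j) 1 =
          insertZero p (ν - Finsupp.single j 1) := by
        refine eq_insertZero_iff.2 ⟨by simp, fun i => ?_⟩
        simp [Finsupp.single_apply]
      rw [specializeZero_X_succAbove, coeff_mul_X', hP, this]
      simp

theorem idealJ_le_ker_constantCoeff (n : ℕ) :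
    idealJ n ≤ RingHom.ker (constantCoeff : MvPolynomial (Fin n) ℚ →+* ℚ) :=
  Ideal.span_le.2 fun _ h => h.2

theorem IsQuasiSymmetric.specializeZero {n : ℕ} {P : MvPolynomial (Fin (n + 1)) ℚ}
    (h : IsQuasiSymmetric P) (p : Fin (n + 1)) :
    IsQuasiSymmetric (specializeZero p P) := by
  intro ν μ hνμ
  rw [coeff_specializeZero, coeff_specializeZero]
  exact h _ _ (by rwa [blocks_comp_insertZero, blocks_comp_insertZero])

/-- Specialization reads the coefficients at exponents with a zero inserted, and the place of a zero
does not affect the composition. -/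
theorem IsQuasiSymmetric.specializeZero_eq {n : ℕ} {P : MvPolynomial (Fin (n + 1)) ℚ}
    (h : IsQuasiSymmetric P) (p q : Fin (n + 1)) :
    QuasiSym.specializeZero p P = QuasiSym.specializeZero q P := by
  ext ν
  rw [coeff_specializeZero, coeff_specializeZero]
  exact h _ _ (by rw [blocks_comp_insertZero, blocks_comp_insertZero])

theorem specializeZero_mem_idealJ {n : ℕ} (p : Fin (n + 1)) {P : MvPolynomial (Fin (n + 1)) ℚ}
    (h : P ∈ idealJ (n + 1)) : specializeZero p P ∈ idealJ n := by
  have : idealJ (n + 1) ≤ (idealJ n).comap (specializeZero p) := by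
    refine Ideal.span_le.2 fun P hP => Ideal.subset_span ⟨hP.1.specializeZero p, ?_⟩
    have h0 : insertZero p 0 = 0 := (eq_insertZero_iff.2 (by simp)).symm
    rw [constantCoeff_eq, coeff_specializeZero, h0, ← constantCoeff_eq]
    exact hP.2
  exact this h

/-- The two specializations are algebra maps that agree modulo `x_i` on variables: at each of the
two positions involved, one gives `x_i` and the other `0`. -/
theorem exists_X_mul_eq_specializeZero_sub {n : ℕ} (i : Fin n)
    (P : MvPolynomial (Fin (n + 1)) ℚ) :
    ∃ Q, X i * Q = specializeZero i.succ P - specializeZero i.castSucc P := by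
  induction P using MvPolynomial.induction_on with
  | C a => exact ⟨0, by simp [← algebraMap_eq]⟩
  | add P Q hP hQ =>
    obtain ⟨P', hP⟩ := hP
    obtain ⟨Q', hQ⟩ := hQ
    exact ⟨P' + Q', by rw [mul_add, hP, hQ, map_add, map_add]; ring⟩
  | mul_X P j hP =>
    obtain ⟨P', hP⟩ := hP
    obtain ⟨c, hc⟩ : ∃ c, X i * c =
        specializeZero i.succ (X j) - specializeZero i.castSucc (X j) := by
      rcases Fin.eq_self_or_eq_succAbove i.castSucc j with rfl | ⟨j, rfl⟩
      · refine ⟨1, ?_⟩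
        rw [specializeZero_X_same, ← Fin.succAbove_succ_self i, specializeZero_X_succAbove]
        ring
      · rw [specializeZero_X_succAbove]
        rcases lt_trichotomy j i with hj | rfl | hj
        · refine ⟨0, ?_⟩
          rw [Fin.succAbove_of_castSucc_lt _ _ (Fin.castSucc_lt_castSucc_iff.2 hj),
            ← Fin.succAbove_of_castSucc_lt i.succ j
              (lt_trans (Fin.castSucc_lt_castSucc_iff.2 hj) i.castSucc_lt_succ),
            specializeZero_X_succAbove]
          ring
        · refine ⟨-1, ?_⟩
          rw [Fin.succAbove_castSucc_self, specializeZero_X_same]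
          ring
        · refine ⟨0, ?_⟩
          rw [Fin.succAbove_of_le_castSucc _ _ (Fin.castSucc_le_castSucc_iff.2 hj.le),
            ← Fin.succAbove_of_le_castSucc i.succ j (Fin.succ_le_castSucc_iff.2 hj),
            specializeZero_X_succAbove]
          ring
    refine ⟨P' * specializeZero i.succ (X j) + specializeZero i.castSucc P * c, ?_⟩
    rw [map_mul, map_mul]
    linear_combination specializeZero i.succ (X j) * hP + specializeZero i.castSucc P * hc

/-- The quotient of `P(…, xᵢ, 0, …) - P(…, 0, xᵢ, …)` by `xᵢ` is again in the ideal generated by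
quasi-symmetric polynomials without constant term. -/
theorem exists_mem_idealJ_X_mul_eq {n : ℕ} (i : Fin n) {P : MvPolynomial (Fin (n + 1)) ℚ}
    (hP : P ∈ idealJ (n + 1)) :
    ∃ Q ∈ idealJ n, X i * Q = specializeZero i.succ P - specializeZero i.castSucc P := by
  induction hP using Submodule.span_induction with
  | mem P h =>
    exact ⟨0, zero_mem _, by rw [h.1.specializeZero_eq i.succ i.castSucc, mul_zero, sub_self]⟩
  | zero => exact ⟨0, zero_mem _, by simp⟩
  | add P Q _ _ hP hQ =>
    obtain ⟨P', hP', hP⟩ := hP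
    obtain ⟨Q', hQ', hQ⟩ := hQ
    exact ⟨P' + Q', add_mem hP' hQ', by rw [mul_add, hP, hQ, map_add, map_add]; ring⟩
  | smul g P hmem hP =>
    obtain ⟨P', hP', hP⟩ := hP
    obtain ⟨c, hc⟩ := exists_X_mul_eq_specializeZero_sub i g
    -- Twisted Leibniz rule for two ring maps `s`, `t`: `s(gP) - t(gP) = s(g)(s(P) - t(P)) + (s(g) -
    -- t(g))t(P)`.
    refine ⟨specializeZero i.succ g * P' + c * specializeZero i.castSucc P,
      add_mem (Ideal.mul_mem_left _ _ hP')
        (Ideal.mul_mem_left _ _ (specializeZero_mem_idealJ _ hmem)), ?_⟩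
    rw [smul_eq_mul, map_mul, map_mul]
    linear_combination specializeZero i.succ g * hP + specializeZero i.castSucc P * hc

/-- If `η = w0aβ` is a Dyck leading exponent of `P` with `a > 0`, the difference quotient at the
zero has leading exponent `w(a-1)β`. This is again Dyck, for an element of the ideal in one variable
fewer. -/
theorem isTransdiagonal_of_leading {n : ℕ} {P : MvPolynomial (Fin n) ℚ} (hP : P ∈ idealJ n)
    {η : Fin n →₀ ℕ} (hη : coeff η P ≠ 0)
    (hmax : ∀ ν, coeff ν P ≠ 0 → ν ≼[MonomialOrder.degLex] η) : IsTransdiagonal η := by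
  have hne : η ≠ 0 := by
    rintro rfl
    exact hη (idealJ_le_ker_constantCoeff n hP)
  induction n with
  | zero => exact absurd (Subsingleton.elim η 0) hne
  | succ n ih =>
    intro hdyck
    rw [isDyck_iff] at hdyck
    -- The Dyck condition gives `η_1 = 0`, and a vector without gaps starting with `0` is zero.
    obtain ⟨k, hk⟩ : (gaps η).Nonempty := by
      rw [Finset.nonempty_iff_ne_empty]
      intro h0
      have h1 := hdyck 0
      rw [partialSum_succ, partialSum_zero, zero_add] at h1
      exact hne (eq_zero_of_gaps_eq_empty h0 (Nat.le_zero.1 h1))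
    obtain ⟨hk0, hkn, hkpos⟩ := mem_gaps_iff.1 hk
    obtain ⟨i, rfl⟩ : ∃ i : Fin n, k = i.castSucc :=
      ⟨⟨k, by omega⟩, rfl⟩
    obtain ⟨ζ, rfl⟩ := exists_eq_insertZero hk0
    have hζ : 0 < ζ i := by
      rw [← insertZero_apply_succAbove i.castSucc ζ i, Fin.succAbove_castSucc_self]
      exact hkpos
    obtain ⟨Q, hQ, hPQ⟩ := exists_mem_idealJ_X_mul_eq i hP
    have hcoeff : ∀ κ, coeff κ Q = coeff (insertZero i.succ (κ + Finsupp.single i 1)) P -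
        coeff (insertZero i.castSucc (κ + Finsupp.single i 1)) P := by
      intro κ
      rw [← coeff_specializeZero, ← coeff_specializeZero, ← coeff_sub, ← hPQ, add_comm,
        coeff_X_mul]
    have hsub : ζ - Finsupp.single i 1 + Finsupp.single i 1 = ζ :=
      tsub_add_cancel_of_le (by simpa using Nat.succ_le_of_lt hζ)
    have hlead : coeff (ζ - Finsupp.single i 1) Q ≠ 0 := by
      rw [hcoeff, hsub]
      -- Moving the zero after the positive entry gives an exponent above `η`, so nothing cancels
      -- the coefficient of `X^η`.
      have h0 : coeff (insertZero i.succ ζ) P = 0 := by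
        by_contra h0
        exact (insertZero_castSucc_lt i hζ).not_ge (hmax _ h0)
      rw [h0, zero_sub]
      exact neg_ne_zero.2 hη
    have hQmax : ∀ κ, coeff κ Q ≠ 0 →
        κ ≼[MonomialOrder.degLex] (ζ - Finsupp.single i 1) := by
      intro κ hκ
      rw [hcoeff] at hκ
      have h1 : κ + Finsupp.single i 1 ≼[MonomialOrder.degLex] ζ := by
        rw [← insertZero_le_insertZero_iff i.castSucc]
        by_cases h2 : coeff (insertZero i.castSucc (κ + Finsupp.single i 1)) P = 0
        · rw [h2, sub_zero] at hκ
          exact (insertZero_castSucc_le i _).trans (hmax _ hκ)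
        · exact hmax _ h2
      rw [← hsub, map_add, map_add] at h1
      exact le_of_add_le_add_right h1
    refine ih hQ hlead hQmax ?_ ?_
    -- An exponent `0` would be a nonzero constant term of `Q`, which lies in the ideal.
    · intro h0
      rw [h0] at hlead
      exact hlead (idealJ_le_ker_constantCoeff n hQ)
    · rw [isDyck_iff]
      intro m
      -- Up to position `i` the bound is that of `η` at `m`; beyond it, that of `η` at `m + 1` less
      -- the unit subtracted.
      have h1 := partialSum_sub_single hζ (m + 1)
      have h2 := hdyck m
      have h3 := hdyck (m + 1)
      rw [partialSum_insertZero] at h2 h3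
      simp only [Fin.val_castSucc, Nat.add_sub_cancel] at h2 h3
      split_ifs at h1 h2 h3 <;> omega

/-! ### Linear algebra with leading exponents. -/

variable {σ K : Type*} [Field K]

/-- A subspace `V` contains `W` as soon as every leading exponent of `W` is one of `V ∩ W`. -/
theorem le_of_forall_exists_degree_eq (m : MonomialOrder σ)
    {V W : Submodule K (MvPolynomial σ K)}
    (h : ∀ P ∈ W, P ≠ 0 → ∃ v ∈ V, v ∈ W ∧ v ≠ 0 ∧ m.degree v = m.degree P) : W ≤ V := by
  intro P hP
  induction hd : m.toSyn (m.degree P) using WellFoundedLT.induction generalizing P with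
  | ind d ih =>
    subst hd
    rcases eq_or_ne P 0 with rfl | hP0
    · exact V.zero_mem
    obtain ⟨v, hv, hvW, hv0, hdeg⟩ := h P hP hP0
    have hlc : m.leadingCoeff v ≠ 0 := m.leadingCoeff_ne_zero_iff.2 hv0
    set c := m.leadingCoeff P / m.leadingCoeff v with hc
    have hcoeff : coeff (m.degree P) (P - c • v) = 0 := by
      rw [coeff_sub, coeff_smul, ← hdeg, ← MonomialOrder.leadingCoeff, hdeg,
        ← MonomialOrder.leadingCoeff, hc, smul_eq_mul, div_mul_cancel₀ _ hlc, sub_self]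
    have hle : m.degree (P - c • v) ≼[m] m.degree P := by
      refine m.degree_sub_le.trans (sup_le le_rfl ?_)
      rw [← hdeg]
      exact m.degree_smul_le
    -- The leading terms cancel, so the difference is zero or has a strictly smaller leading
    -- exponent.
    have hQ : P - c • v ∈ V := by
      rcases eq_or_ne (P - c • v) 0 with h0 | h0
      · rw [h0]
        exact V.zero_mem
      · refine ih _ (lt_of_le_of_ne hle fun he => h0 ?_) (W.sub_mem hP (W.smul_mem c hvW)) rfl
        rw [← m.leadingCoeff_eq_zero_iff, MonomialOrder.leadingCoeff,
          m.toSyn.injective he, hcoeff]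
    simpa using V.add_mem hQ (V.smul_mem c hv)

/-- Polynomials with distinct leading exponents are linearly independent. -/
theorem linearIndependent_of_degree_injective (m : MonomialOrder σ) {ι : Type*}
    {v : ι → MvPolynomial σ K} (hv : ∀ i, v i ≠ 0)
    (hinj : Function.Injective fun i => m.degree (v i)) : LinearIndependent K v := by
  classical
  rw [linearIndependent_iff]
  intro l hl
  by_contra hne
  -- At the largest leading exponent in the relation only one of the polynomials contributes.
  obtain ⟨i, hi, hmax⟩ := Finset.exists_max_image l.support (fun i => m.toSyn (m.degree (v i)))
    (Finsupp.support_nonempty_iff.2 hne)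
  have h := congrArg (coeff (m.degree (v i))) hl
  rw [Finsupp.linearCombination_apply, Finsupp.sum, coeff_sum, Finset.sum_eq_single i] at h
  · rw [coeff_smul, coeff_zero, smul_eq_mul, ← MonomialOrder.leadingCoeff] at h
    exact mul_ne_zero (Finsupp.mem_support_iff.1 hi) (m.leadingCoeff_ne_zero_iff.2 (hv i)) h
  · intro j hj hji
    rw [coeff_smul, m.coeff_eq_zero_of_lt, smul_zero]
    exact lt_of_le_of_ne (hmax j hj) fun he => hji (hinj (m.toSyn.injective he))
  · exact fun h => absurd hi h

/-! ### The bases and the Gröbner property. -/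

theorem polyG_ne_zero {n : ℕ} (ε : Fin n →₀ ℕ) : polyG ε ≠ 0 := by
  intro h
  have := coeff_polyG_self ε
  simp [h] at this

theorem isTransdiagonal_degree {n : ℕ} {P : MvPolynomial (Fin n) ℚ} (hP : P ∈ idealJ n)
    (h0 : P ≠ 0) : IsTransdiagonal (MonomialOrder.degLex.degree P) :=
  isTransdiagonal_of_leading hP (MonomialOrder.degLex.leadingCoeff_ne_zero_iff.2 h0)
    fun _ hν => MonomialOrder.le_degree (mem_support_iff.2 hν)

theorem idealJ_le_span_polyG (n : ℕ) : (idealJ n).restrictScalars ℚ ≤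
    Submodule.span ℚ (Set.range fun ε : {ε : Fin n →₀ ℕ // IsTransdiagonal ε} => polyG ε.1) :=
  le_of_forall_exists_degree_eq MonomialOrder.degLex fun P hP h0 =>
    have ht := isTransdiagonal_degree hP h0
    ⟨polyG (MonomialOrder.degLex.degree P), Submodule.subset_span ⟨⟨_, ht⟩, rfl⟩,
      polyG_mem_idealJ _ ht, polyG_ne_zero _, degree_polyG _⟩

/-- Every exponent is the leading exponent of a vector on the right: of `X^η` itself if it is Dyck,
of `G_η` otherwise. -/
theorem span_monomial_sup_idealJ (n : ℕ) :
    (⊤ : Submodule ℚ (MvPolynomial (Fin n) ℚ)) ≤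
      Submodule.span ℚ (Set.range fun η : {η : Fin n →₀ ℕ // IsDyck η} => monomial η.1 (1 : ℚ)) ⊔
        (idealJ n).restrictScalars ℚ := by
  classical
  refine le_of_forall_exists_degree_eq MonomialOrder.degLex fun P _ h0 => ?_
  by_cases h : IsDyck (MonomialOrder.degLex.degree P)
  · refine ⟨monomial (MonomialOrder.degLex.degree P) 1,
      Submodule.mem_sup_left (Submodule.subset_span ⟨⟨_, h⟩, rfl⟩), trivial, ?_, ?_⟩
    · simp
    · rw [MonomialOrder.degree_monomial, if_neg one_ne_zero]
  · exact ⟨_, Submodule.mem_sup_right (polyG_mem_idealJ _ h), trivial, polyG_ne_zero _,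
      degree_polyG _⟩

/-- A relation is a combination of Dyck monomials lying in the ideal. If it were nonzero, its
leading exponent would be both Dyck and transdiagonal. -/
theorem linearIndependent_mk_monomial (n : ℕ) :
    LinearIndependent ℚ fun η : {η : Fin n →₀ ℕ // IsDyck η} =>
      Ideal.Quotient.mk (idealJ n) (monomial η.1 (1 : ℚ)) := by
  classical
  rw [linearIndependent_iff]
  intro l hl
  set P : MvPolynomial (Fin n) ℚ := l.sum fun η a => monomial η.1 a with hPdef
  have hP : P ∈ idealJ n := by
    rw [← Ideal.Quotient.eq_zero_iff_mem, ← hl, hPdef, Finsupp.linearCombination_apply,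
      map_finsuppSum]
    refine Finsupp.sum_congr fun η _ => ?_
    rw [← Ideal.Quotient.mkₐ_eq_mk ℚ, ← map_smul, smul_monomial, smul_eq_mul, mul_one]
  have hcoeff : ∀ ν, coeff ν P = if h : IsDyck ν then l ⟨ν, h⟩ else 0 := by
    intro ν
    rw [hPdef, Finsupp.sum, coeff_sum]
    simp only [coeff_monomial]
    split_ifs with h
    · rw [Finset.sum_eq_single ⟨ν, h⟩]
      · simp
      · exact fun η _ hη => if_neg fun he => hη (Subtype.ext he)
      · intro h0
        simpa using h0
    · exact Finset.sum_eq_zero fun η _ => if_neg fun (he : η.1 = ν) => h (he ▸ η.2)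
  have hP0 : P = 0 := by
    by_contra h0
    have h1 := MonomialOrder.degLex.leadingCoeff_ne_zero_iff.2 h0
    rw [MonomialOrder.leadingCoeff, hcoeff, dif_neg (isTransdiagonal_degree hP h0)] at h1
    exact h1 rfl
  ext η
  have := hcoeff η.1
  rw [hP0, coeff_zero, dif_pos η.2] at this
  exact this.symm

theorem span_mk_monomial (n : ℕ) :
    ⊤ ≤ Submodule.span ℚ (Set.range fun η : {η : Fin n →₀ ℕ // IsDyck η} =>
      Ideal.Quotient.mk (idealJ n) (monomial η.1 (1 : ℚ))) := by
  intro x _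
  obtain ⟨P, rfl⟩ := Ideal.Quotient.mk_surjective x
  obtain ⟨Q, hQ, R, hR, rfl⟩ := Submodule.mem_sup.1 (span_monomial_sup_idealJ n
    (Submodule.mem_top (x := P)))
  rw [map_add, Ideal.Quotient.eq_zero_iff_mem.2 hR, add_zero]
  have := Submodule.mem_map_of_mem (f := (Ideal.Quotient.mkₐ ℚ (idealJ n)).toLinearMap) hQ
  rwa [Submodule.map_span, ← Set.range_comp] at this

/-- The leading term of a nonzero `P` in the ideal is a scalar multiple of that of `G_ε`, where `ε`
is the leading exponent of `P`. -/
theorem isGroebnerBasis_polyG (n : ℕ) :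
    IsGroebnerBasis MonomialOrder.degLex (polyG '' {ε : Fin n →₀ ℕ | IsTransdiagonal ε})
      (idealJ n) := by
  have hsub : polyG '' {ε : Fin n →₀ ℕ | IsTransdiagonal ε} ⊆
      (idealJ n : Set (MvPolynomial (Fin n) ℚ)) := by
    rintro _ ⟨ε, hε, rfl⟩
    exact polyG_mem_idealJ ε hε
  refine ⟨hsub, le_antisymm (Ideal.span_le.2 ?_) (Ideal.span_mono (Set.image_mono hsub))⟩
  rintro _ ⟨P, hP, rfl⟩
  rcases eq_or_ne P 0 with rfl | h0
  · rw [MonomialOrder.leadingTerm_zero]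
    exact zero_mem _
  · have h1 : MonomialOrder.degLex.leadingTerm P = C (MonomialOrder.degLex.leadingCoeff P) *
        MonomialOrder.degLex.leadingTerm (polyG (MonomialOrder.degLex.degree P)) := by
      rw [MonomialOrder.leadingTerm, MonomialOrder.leadingTerm, degree_polyG, leadingCoeff_polyG,
        C_mul_monomial, mul_one]
    rw [h1]
    exact Ideal.mul_mem_left _ _ (Ideal.subset_span
      ⟨_, ⟨_, isTransdiagonal_degree hP h0, rfl⟩, rfl⟩)

end QuasiSym

theorem theorem2 (n : ℕ) :
    (∃ b : Module.Basis {η : Fin n →₀ ℕ // QuasiSym.IsDyck η} ℚ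
        (MvPolynomial (Fin n) ℚ ⧸ QuasiSym.idealJ n),
      ∀ η, b η = Ideal.Quotient.mk (QuasiSym.idealJ n) (MvPolynomial.monomial η.1 1)) ∧
    (∃ g : Module.Basis {ε : Fin n →₀ ℕ // QuasiSym.IsTransdiagonal ε} ℚ
        ((QuasiSym.idealJ n).restrictScalars ℚ),
      ∀ ε, (g ε : MvPolynomial (Fin n) ℚ) = QuasiSym.polyG ε.1) ∧
    QuasiSym.IsGroebnerBasis MonomialOrder.degLex
      (QuasiSym.polyG '' {ε : Fin n →₀ ℕ | QuasiSym.IsTransdiagonal ε}) (QuasiSym.idealJ n) := by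
  refine ⟨⟨Module.Basis.mk (QuasiSym.linearIndependent_mk_monomial n)
    (QuasiSym.span_mk_monomial n), fun η => Module.Basis.mk_apply _ _ η⟩, ?_,
    QuasiSym.isGroebnerBasis_polyG n⟩
  have hli : LinearIndependent ℚ
      fun ε : {ε : Fin n →₀ ℕ // QuasiSym.IsTransdiagonal ε} => QuasiSym.polyG ε.1 := by
    refine QuasiSym.linearIndependent_of_degree_injective MonomialOrder.degLex
      (fun ε => QuasiSym.polyG_ne_zero _) fun ε ε' h => Subtype.ext ?_
    simpa only [QuasiSym.degree_polyG] using h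
  have hspan : Submodule.span ℚ (Set.range fun ε : {ε : Fin n →₀ ℕ //
      QuasiSym.IsTransdiagonal ε} => QuasiSym.polyG ε.1) =
      (QuasiSym.idealJ n).restrictScalars ℚ := by
    refine le_antisymm (Submodule.span_le.2 ?_) (QuasiSym.idealJ_le_span_polyG n)
    rintro _ ⟨ε, rfl⟩
    exact QuasiSym.polyG_mem_idealJ _ ε.2
  exact ⟨(Module.Basis.span hli).map (LinearEquiv.ofEq _ _ hspan),
    fun ε => by rw [Module.Basis.map_apply, LinearEquiv.coe_ofEq_apply, Module.Basis.span_apply]⟩
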